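/- For a closed set $S\subset\mathbb R$ let $B_S$ be the Bernstein space of bounded (continuous) functions $f:\mathbb R\to\mathbb C$, with the sup-norm, that are Fourier transforms $f=\hat F$, $\hat F(x)=\int_{\mathbb R} e^{itx}F(t)\,dt$ in the sense of distributions, of tempered distributions $F$ supported by $S$. Call a Borel probability measure $\nu$ on $\mathbb R$ a Menshov measure if it is singular with respect to Lebesgue measure, its support is compact and has Lebesgue measure zero, and $\hat\nu(x)=\int_{\mathbb R} e^{ixt}\,d\nu(t)\to 0$ as $|x|\to\infty$. For every $\varepsilon>0$ there are a compact set $S\subset\mathbb R$ of Lebesgue measure zero and a function $f\in B_S$ such that $$f(0)=\|f\|_{L^\infty(\mathbb R)}=1 \quad\text{and}\quad |f(t)|<\varepsilon \ \text{ for all } t\in\mathbb R \text{ with } |t|>\varepsilon ;$$ moreover, $f$ can be taken of the form $f(x)=\hat\nu(cx)$, $x\in\mathbb R$, for some Menshov measure $\nu$ and some $c>0$. -/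

import Mathlib

open MeasureTheory Filter Topology
open scoped SchwartzMap BoundedContinuousFunction FourierTransform

/-- The Fourier transform `φ ↦ φ̂`, `φ̂(t) = ∫ e^{itx} φ(x) dx`, on Schwartz functions on the line,
as a continuous linear map. It is Mathlib's inverse Fourier transform (with kernel `e^{2πitx}`)
followed by the substitution `t ↦ t / 2π`; see `expFourier_apply`. -/
noncomputable def expFourier : 𝓢(ℝ, ℂ) →L[ℂ] 𝓢(ℝ, ℂ) :=
  (SchwartzMap.compCLMOfContinuousLinearEquiv ℂ
    (ContinuousLinearEquiv.smulLeft (Units.mk0 ((2 * Real.pi)⁻¹ : ℝ)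
      (inv_ne_zero Real.two_pi_pos.ne')) : ℝ ≃L[ℝ] ℝ)).comp
    (FourierTransform.fourierInvCLM ℂ 𝓢(ℝ, ℂ))

theorem expFourier_apply (φ : 𝓢(ℝ, ℂ)) (t : ℝ) :
    expFourier φ t = ∫ x : ℝ, Complex.exp (Complex.I * t * x) * φ x := by
  have h : expFourier φ t = (𝓕⁻ (φ : ℝ → ℂ)) ((2 * Real.pi)⁻¹ * t) := by
    rw [← SchwartzMap.fourierInv_coe]; rfl
  rw [h, Real.fourierInv_eq']
  refine integral_congr_ae (Eventually.of_forall fun x => ?_)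
  have hp : (Real.pi : ℂ) ≠ 0 := by exact_mod_cast Real.pi_ne_zero
  simp only [smul_eq_mul, RCLike.inner_apply, conj_trivial]
  congr 2
  push_cast
  field_simp

/-- The Fourier transform of the tempered distribution `F`, with kernel `e^{itx}`, is the function
`f`: that is, `⟨F, φ̂⟩ = ∫ f φ` for every Schwartz function `φ`. -/
def IsFourierTransformOf (f : ℝ →ᵇ ℂ) (F : 𝓢'(ℝ, ℂ)) : Prop :=
  ∀ φ : 𝓢(ℝ, ℂ), F (expFourier φ) = ∫ x : ℝ, f x * φ x

theorem integrable_bcf_mul_schwartz (f : ℝ →ᵇ ℂ) (φ : 𝓢(ℝ, ℂ)) :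
    Integrable (fun x : ℝ => f x * φ x) :=
  φ.integrable.bdd_mul f.continuous.aestronglyMeasurable
    (Eventually.of_forall f.norm_coe_le_norm)

/-- The Bernstein space `B_S` of a closed set `S ⊆ ℝ`: all bounded functions which are the Fourier
transform of a distribution supported by `S`, with the sup-norm (the norm of `ℝ →ᵇ ℂ`).
If `S` is compact, then the Fourier transform of such a distribution is a smooth function, hence
nothing is lost by taking `f` continuous, and the values `f x` are the actual ones.
A distribution is supported by the closed set `S` if it vanishes on the open set `Sᶜ`. -/
noncomputable def BernsteinSpace (S : Set ℝ) : Submodule ℂ (ℝ →ᵇ ℂ) where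
  carrier := {f | ∃ F : 𝓢'(ℝ, ℂ), Distribution.IsVanishingOn F Sᶜ ∧ IsFourierTransformOf f F}
  zero_mem' := ⟨0, fun _ _ => rfl, fun φ => by simp⟩
  add_mem' := by
    rintro f g ⟨F, hF, hf⟩ ⟨G, hG, hg⟩
    refine ⟨F + G, fun u hu => ?_, fun φ => ?_⟩
    · change F u + G u = 0
      rw [hF u hu, hG u hu, add_zero]
    · change F (expFourier φ) + G (expFourier φ) = _
      rw [hf φ, hg φ, ← integral_add (integrable_bcf_mul_schwartz f φ)
        (integrable_bcf_mul_schwartz g φ)]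
      simp [add_mul]
  smul_mem' := by
    rintro c f ⟨F, hF, hf⟩
    refine ⟨c • F, fun u hu => ?_, fun φ => ?_⟩
    · change c • F u = 0
      rw [hF u hu, smul_zero]
    · change c • F (expFourier φ) = _
      rw [hf φ, ← integral_smul]
      simp [mul_assoc]

/-- A Menshov measure: a probability measure on the line, singular with compact support of
Lebesgue measure zero, whose Fourier transform `ν̂(x) = ∫ e^{ixt} dν(t)` (`charFun ν x`)
tends to zero at infinity. -/
structure IsMenshovMeasure (ν : Measure ℝ) : Prop where
  isProbabilityMeasure : IsProbabilityMeasure ν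
  singular : ν ⟂ₘ volume
  isCompact_support : IsCompact ν.support
  volume_support : volume ν.support = 0
  tendsto_zero : Tendsto (charFun ν) (cocompact ℝ) (𝓝 0)

/-! The measure is the Bernoulli convolution with ratio `r = 2/5`. It lives on a compact set `K`
contained in `r K ∪ (1 + r K)`, and `2r < 1` makes `K` null (`volume_range_digitSeries`). The
modulus of its characteristic function is an infinite product of `|cos (r ^ k * t / 2)|`. If it
failed to decay along `t (5/2)^n`, the numbers `y (5/2)^n` would approach the integers for some `y >
0`. This is impossible because `5/2` is not an algebraic integer
(`not_tendsto_sub_round_geometric`); it is the Erdős–Salem criterion in an elementary case. Dini's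
theorem then makes the decay uniform. A large dilation pushes the region where the transform is not
small into `|t| ≤ ε`; the value at `0` stays `1`, which is the sup-norm. -/

/-- The fair coin on `Bool`. -/
noncomputable def fairCoin : Measure Bool :=
  (2 : ENNReal)⁻¹ • (Measure.dirac false + Measure.dirac true)

instance : IsProbabilityMeasure fairCoin :=
  ⟨by simp [fairCoin, ENNReal.inv_two_add_inv_two]⟩

/-- The value `0` or `r ^ n` of the `n`-th digit. -/
noncomputable def digitValue (r : ℝ) (n : ℕ) (b : Bool) : ℝ := if b then r ^ n else 0

/-- The sum `∑ ωₙ rⁿ` of a sequence of digits `0` and `1`. -/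
noncomputable def digitSeries (r : ℝ) (ω : ℕ → Bool) : ℝ := ∑' n, digitValue r n (ω n)

/-- The Bernoulli convolution with ratio `r`: the law of `∑ ωₙ rⁿ` for independent fair digits. -/
noncomputable def bernoulliConvolution (r : ℝ) : Measure ℝ :=
  (Measure.infinitePi fun _ : ℕ => fairCoin).map (digitSeries r)

theorem norm_digitValue_le {r : ℝ} (h0 : 0 ≤ r) (n : ℕ) (b : Bool) : ‖digitValue r n b‖ ≤ r ^ n := by
  have := pow_nonneg h0 n
  cases b <;> simp [digitValue, abs_of_nonneg h0, this]

@[fun_prop]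
theorem measurable_digitValue (r : ℝ) (n : ℕ) : Measurable (digitValue r n) :=
  measurable_of_finite _

theorem summable_digitValue {r : ℝ} (h0 : 0 ≤ r) (h1 : r < 1) (ω : ℕ → Bool) :
    Summable fun n => digitValue r n (ω n) :=
  Summable.of_norm_bounded (summable_geometric_of_lt_one h0 h1)
    fun n => norm_digitValue_le h0 n (ω n)

theorem continuous_digitSeries {r : ℝ} (h0 : 0 ≤ r) (h1 : r < 1) :
    Continuous (digitSeries r) :=
  continuous_tsum (fun n => (continuous_of_discreteTopology (f := digitValue r n)).comp
    (continuous_apply n)) (summable_geometric_of_lt_one h0 h1)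
    fun n ω => norm_digitValue_le h0 n (ω n)

theorem digitSeries_eq {r : ℝ} (h0 : 0 ≤ r) (h1 : r < 1) (ω : ℕ → Bool) :
    digitSeries r ω = (if ω 0 then 1 else 0) + r * digitSeries r fun n => ω (n + 1) := by
  rw [digitSeries, (summable_digitValue h0 h1 ω).tsum_eq_zero_add, digitSeries, ← tsum_mul_left]
  have h (n : ℕ) : digitValue r (n + 1) (ω (n + 1)) = r * digitValue r n (ω (n + 1)) := by
    simp [digitValue, pow_succ']
  simp_rw [h]
  simp [digitValue]

instance (r : ℝ) [h : Fact (0 ≤ r ∧ r < 1)] : IsProbabilityMeasure (bernoulliConvolution r) :=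
  Measure.isProbabilityMeasure_map (continuous_digitSeries h.out.1 h.out.2).measurable.aemeasurable

theorem isCompact_range_digitSeries {r : ℝ} (h0 : 0 ≤ r) (h1 : r < 1) :
    IsCompact (Set.range (digitSeries r)) :=
  isCompact_range (continuous_digitSeries h0 h1)

open scoped Pointwise in
-- Self-similarity gives `|K| ≤ 2r|K|`; since `|K|` is finite and `2r < 1`, it vanishes.
theorem volume_range_digitSeries {r : ℝ} (h0 : 0 ≤ r) (h1 : r < 1 / 2) :
    volume (Set.range (digitSeries r)) = 0 := by
  set K := Set.range (digitSeries r) with hK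
  have hr : r < 1 := by linarith
  have hsub : K ⊆ (r • K) ∪ ((1 : ℝ) +ᵥ (r • K)) := by
    rintro _ ⟨ω, rfl⟩
    have hmem : r * digitSeries r (fun n => ω (n + 1)) ∈ r • K :=
      Set.smul_mem_smul_set (Set.mem_range_self _)
    rw [digitSeries_eq h0 hr]
    cases ω 0
    · left; simpa using hmem
    · right; simpa using Set.vadd_mem_vadd_set (a := (1 : ℝ)) hmem
  have hfin : volume K ≠ ⊤ := (isCompact_range_digitSeries h0 hr).measure_lt_top.ne
  have hle : volume K ≤ ENNReal.ofReal r * volume K + ENNReal.ofReal r * volume K := by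
    refine (measure_mono hsub).trans ((measure_union_le _ _).trans ?_)
    rw [measure_vadd, Measure.addHaar_smul]
    simp [abs_of_nonneg h0]
  lift volume K to NNReal using hfin with v
  rw [ENNReal.ofReal] at hle
  have hle' : (v : ℝ) ≤ r * v + r * v := by
    have h2 : v ≤ r.toNNReal * v + r.toNNReal * v := by exact_mod_cast hle
    have h3 := NNReal.coe_le_coe.2 h2
    simpa [Real.coe_toNNReal r h0] using h3
  have hv : (v : ℝ) = 0 := by nlinarith [v.2]
  exact_mod_cast hv

theorem bernoulliConvolution_compl_range {r : ℝ} (h0 : 0 ≤ r) (h1 : r < 1) :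
    bernoulliConvolution r (Set.range (digitSeries r))ᶜ = 0 := by
  rw [bernoulliConvolution, Measure.map_apply (continuous_digitSeries h0 h1).measurable
    (isCompact_range_digitSeries h0 h1).measurableSet.compl]
  have h : digitSeries r ⁻¹' (Set.range (digitSeries r))ᶜ = ∅ := by
    ext ω
    simp
  rw [h, measure_empty]

/-! ### The characteristic function as an infinite product -/

theorem charFun_map_digitValue (r : ℝ) (n : ℕ) (t : ℝ) :
    charFun (fairCoin.map (digitValue r n)) t = (1 + Complex.exp ((r ^ n * t : ℝ) * Complex.I)) / 2 := by
  rw [charFun_apply_real, integral_map (measurable_digitValue r n).aemeasurable (by fun_prop), fairCoin,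
    integral_smul_measure, integral_add_measure (integrable_dirac (by simp))
      (integrable_dirac (by simp)), integral_dirac, integral_dirac]
  simp [digitValue]
  ring_nf

theorem charFun_partialSum (r : ℝ) (n : ℕ) (t : ℝ) :
    ∫ ω, Complex.exp (t * (∑ k ∈ Finset.range n, digitValue r k (ω k) : ℝ) * Complex.I)
      ∂(Measure.infinitePi fun _ : ℕ => fairCoin) =
      ∏ k ∈ Finset.range n, (1 + Complex.exp ((r ^ k * t : ℝ) * Complex.I)) / 2 := by
  have hind := ProbabilityTheory.iIndepFun_infinitePi (P := fun _ : ℕ => fairCoin)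
    (X := fun k => digitValue r k) (measurable_digitValue r)
  have hind' := hind.precomp (g := fun i : Fin n => (i : ℕ)) Fin.val_injective
  have h := hind'.charFun_map_fun_sum_eq_prod (fun i => Measurable.aemeasurable (by fun_prop))
  have h' := congrFun h t
  rw [charFun_apply_real,
    integral_map (Measurable.aemeasurable (by fun_prop)) (by fun_prop), Finset.prod_apply] at h'
  rw [Finset.prod_range]
  simp_rw [Finset.sum_range]
  refine h'.trans (Finset.prod_congr rfl fun k _ => ?_)
  rw [← charFun_map_digitValue]
  conv_rhs => rw [← Measure.infinitePi_map_eval (fun _ : ℕ => fairCoin) k,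
    Measure.map_map (by fun_prop) (by fun_prop)]
  rfl

theorem tendsto_prod_charFun {r : ℝ} (h0 : 0 ≤ r) (h1 : r < 1) (t : ℝ) :
    Tendsto (fun n => ∏ k ∈ Finset.range n, (1 + Complex.exp ((r ^ k * t : ℝ) * Complex.I)) / 2)
      atTop (𝓝 (charFun (bernoulliConvolution r) t)) := by
  simp_rw [← charFun_partialSum]
  rw [charFun_apply_real, bernoulliConvolution,
    integral_map (continuous_digitSeries h0 h1).measurable.aemeasurable (by fun_prop)]
  refine tendsto_integral_of_dominated_convergence (fun _ => 1)
    (fun n => ?_) (integrable_const _) (fun n => .of_forall fun ω => ?_) (.of_forall fun ω => ?_)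
  · exact Measurable.aestronglyMeasurable (by fun_prop)
  · rw [← Complex.ofReal_mul, Complex.norm_exp_ofReal_mul_I]
  · have h := (summable_digitValue h0 h1 ω).hasSum.tendsto_sum_nat
    have hc : Continuous fun x : ℝ => Complex.exp (t * x * Complex.I) := by fun_prop
    exact (hc.tendsto _).comp h

theorem charFun_bernoulliConvolution {r : ℝ} (h0 : 0 ≤ r) (h1 : r < 1) (t : ℝ) :
    charFun (bernoulliConvolution r) t =
      (1 + Complex.exp (t * Complex.I)) / 2 * charFun (bernoulliConvolution r) (r * t) := by
  refine tendsto_nhds_unique ((tendsto_add_atTop_iff_nat 1).2 (tendsto_prod_charFun h0 h1 t)) ?_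
  convert (tendsto_prod_charFun h0 h1 (r * t)).const_mul ((1 + Complex.exp (t * Complex.I)) / 2)
    using 2 with n
  rw [Finset.prod_range_succ', mul_comm]
  simp [pow_succ, mul_assoc]

theorem norm_one_add_exp_div_two (t : ℝ) :
    ‖(1 + Complex.exp (t * Complex.I)) / 2‖ = |Real.cos (t / 2)| := by
  have h : (1 + Complex.exp (t * Complex.I)) / 2
      = Complex.exp ((t / 2 : ℝ) * Complex.I) * (Real.cos (t / 2) : ℝ) := by
    rw [Complex.ofReal_cos, Complex.cos, mul_div_assoc', mul_add, ← Complex.exp_add,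
      ← Complex.exp_add]
    push_cast
    ring_nf
    simp
    ring
  rw [h, norm_mul, Complex.norm_exp_ofReal_mul_I, one_mul, Complex.norm_real, Real.norm_eq_abs]

theorem norm_charFun_bernoulliConvolution {r : ℝ} (h0 : 0 ≤ r) (h1 : r < 1) (t : ℝ) :
    ‖charFun (bernoulliConvolution r) t‖ =
      |Real.cos (t / 2)| * ‖charFun (bernoulliConvolution r) (r * t)‖ := by
  rw [charFun_bernoulliConvolution h0 h1, norm_mul, norm_one_add_exp_div_two]

/-! ### Decay at infinity -/

theorem abs_cos_pi_mul_le (y : ℝ) : |Real.cos (Real.pi * y)| ≤ 1 - 2 * (y - round y) ^ 2 := by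
  have h1 := abs_sub_round y
  have h2 : |Real.cos (Real.pi * y)| = |Real.cos (Real.pi * (y - round y))| := by
    rw [mul_sub, mul_comm Real.pi (round y : ℝ), Real.cos_sub_int_mul_pi, abs_mul]
    simp
  have hpi := Real.pi_pos
  have h3 : |Real.pi * (y - round y)| ≤ Real.pi / 2 := by
    rw [abs_mul, abs_of_pos hpi]
    nlinarith
  rw [h2, abs_of_nonneg (Real.cos_nonneg_of_mem_Icc (abs_le.1 h3))]
  refine (Real.cos_le_one_sub_mul_cos_sq (h3.trans (by linarith))).trans_eq ?_
  field_simp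

/-- The distances to the nearest integer of `y (5/2)ⁿ` do not tend to zero. -/
theorem not_tendsto_sub_round_geometric {y : ℝ} (hy : 0 < y) :
    ¬ Tendsto (fun n : ℕ => y * (5 / 2) ^ n - round (y * (5 / 2) ^ n)) atTop (𝓝 0) := by
  intro h
  set a : ℕ → ℤ := fun n => round (y * (5 / 2 : ℝ) ^ n) with ha
  -- With errors below `1/7`, the integer `2 a (n+1) - 5 a n` has modulus below `(2 + 5)/7 = 1`,
  -- hence is zero.
  have hsmall : ∀ᶠ n : ℕ in atTop, |y * (5 / 2) ^ n - a n| < 1 / 7 := by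
    simpa using (tendsto_order.1 h.abs).2 (1 / 7) (by norm_num)
  have hlarge : ∀ᶠ n : ℕ in atTop, 1 ≤ y * (5 / 2 : ℝ) ^ n :=
    ((tendsto_pow_atTop_atTop_of_one_lt (by norm_num : (1 : ℝ) < 5 / 2)).const_mul_atTop
      hy).eventually_ge_atTop 1
  obtain ⟨N, hN⟩ := eventually_atTop.1 (hsmall.and hlarge)
  have hrec (n : ℕ) (hn : N ≤ n) : 2 * a (n + 1) = 5 * a n := by
    have h1 := abs_lt.1 (hN n hn).1
    have h2 := abs_lt.1 (hN (n + 1) (by omega)).1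
    rw [pow_succ] at h2
    have h3 : (2 * a (n + 1) : ℝ) < 5 * a n + 1 := by linarith
    have h4 : (5 * a n : ℝ) < 2 * a (n + 1) + 1 := by linarith
    have h3' : 2 * a (n + 1) < 5 * a n + 1 := by exact_mod_cast h3
    have h4' : 5 * a n < 2 * a (n + 1) + 1 := by exact_mod_cast h4
    omega
  -- Each use of the recurrence gains a factor `2`, so every power of `2` divides the positive
  -- integer `a N`.
  have hdvd (m : ℕ) : ∀ n, N ≤ n → (2 : ℤ) ^ m ∣ a n := by
    induction m with
    | zero => simp
    | succ m ih =>
      intro n hn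
      have h1 : (2 : ℤ) ^ (m + 1) ∣ 5 * a n := by
        rw [← hrec n hn, pow_succ']
        exact mul_dvd_mul_left 2 (ih (n + 1) (by omega))
      exact (IsCoprime.pow_left (by norm_num)).dvd_of_dvd_mul_left h1
  have hpos : 0 < a N := by
    have h1 := abs_lt.1 (hN N le_rfl).1
    have h2 := (hN N le_rfl).2
    have h3 : (0 : ℝ) < a N := by linarith
    exact_mod_cast h3
  have h1 := Int.le_of_dvd hpos (hdvd (a N).toNat N le_rfl)
  have h2 : (a N).toNat < 2 ^ (a N).toNat := Nat.lt_two_pow_self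
  have h3 : ((a N).toNat : ℤ) < 2 ^ (a N).toNat := by exact_mod_cast h2
  omega

/-- A nonnegative solution of `g (5t/2) = |cos (5t/4)| g t` tends to zero along geometric
progressions with ratio `5/2`. -/
theorem tendsto_geometric_of_functional_equation {g : ℝ → ℝ} (hg0 : ∀ t, 0 ≤ g t)
    (hg : ∀ t, g t = |Real.cos (t / 2)| * g (2 / 5 * t)) {t : ℝ} (ht : 0 < t) :
    Tendsto (fun n : ℕ => g (t * (5 / 2) ^ n)) atTop (𝓝 0) := by
  set u : ℕ → ℝ := fun n => g (t * (5 / 2) ^ n) with hu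
  have hstep (n : ℕ) : u (n + 1) = |Real.cos (t * (5 / 2) ^ (n + 1) / 2)| * u n := by
    simp only [hu]
    rw [hg]
    congr 2
    ring
  have hanti : Antitone u := antitone_nat_of_succ_le fun n => by
    rw [hstep]
    exact mul_le_of_le_one_left (hg0 _) (Real.abs_cos_le_one _)
  have hbdd : BddBelow (Set.range u) := ⟨0, by rintro _ ⟨n, rfl⟩; exact hg0 _⟩
  have hlim := tendsto_atTop_ciInf hanti hbdd
  set l := ⨅ n, u n with hl
  rcases (le_ciInf fun n => hg0 _ : 0 ≤ l).eq_or_lt with h | hpos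
  · rwa [h]
  exfalso
  have hupos (n : ℕ) : 0 < u n := hpos.trans_le (ciInf_le hbdd n)
  -- A positive limit forces the cosine factors to `1` in modulus, so their arguments divided by `π`
  -- approach the integers.
  have hratio : Tendsto (fun n => u (n + 1) / u n) atTop (𝓝 1) := by
    have h := ((tendsto_add_atTop_iff_nat 1).2 hlim).div hlim hpos.ne'
    rwa [div_self hpos.ne'] at h
  have hy : 0 < t * (5 / 2) / (2 * Real.pi) := by positivity
  apply not_tendsto_sub_round_geometric hy
  set y : ℕ → ℝ := fun n => t * (5 / 2) / (2 * Real.pi) * (5 / 2) ^ n with hydef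
  have hle (n : ℕ) : (y n - round (y n)) ^ 2 ≤ (1 - u (n + 1) / u n) / 2 := by
    have h := abs_cos_pi_mul_le (y n)
    have harg : Real.pi * y n = t * (5 / 2) ^ (n + 1) / 2 := by
      simp only [hydef]
      field_simp
      ring
    rw [harg] at h
    rw [hstep, mul_div_cancel_right₀ _ (hupos n).ne']
    linarith
  have hsq : Tendsto (fun n => (y n - round (y n)) ^ 2) atTop (𝓝 0) := by
    refine squeeze_zero (fun n => sq_nonneg _) hle ?_
    simpa using (hratio.const_sub 1).div_const 2
  have habs := hsq.sqrt
  simp only [Real.sqrt_sq_eq_abs, Real.sqrt_zero] at habs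
  exact (tendsto_zero_iff_abs_tendsto_zero _).2 habs

/-- A continuous nonnegative even solution of `g (5t/2) = |cos (5t/4)| g t` tends to zero at
infinity. -/
theorem tendsto_cocompact_of_functional_equation {g : ℝ → ℝ} (hg0 : ∀ t, 0 ≤ g t)
    (hcont : Continuous g) (heven : ∀ t, g (-t) = g t)
    (hg : ∀ t, g t = |Real.cos (t / 2)| * g (2 / 5 * t)) :
    Tendsto g (cocompact ℝ) (𝓝 0) := by
  have hstep (t : ℝ) : g (5 / 2 * t) ≤ g t := by
    rw [hg, show 2 / 5 * (5 / 2 * t) = t by ring]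
    exact mul_le_of_le_one_left (hg0 _) (Real.abs_cos_le_one _)
  have hanti (t : ℝ) : Antitone fun n : ℕ => g (t * (5 / 2) ^ n) :=
    antitone_nat_of_succ_le fun n => by
      rw [show t * (5 / 2) ^ (n + 1) = 5 / 2 * (t * (5 / 2) ^ n) by ring]
      exact hstep _
  -- Dini's theorem on `[1, 5/2]`, into which every `|t| ≥ 1` is brought by a power of `5/2`.
  have hunif := Antitone.tendstoUniformlyOn_of_forall_tendsto
    (F := fun (n : ℕ) t => g (t * (5 / 2) ^ n)) (f := fun _ => 0)
    (isCompact_Icc (a := (1 : ℝ)) (b := 5 / 2)) (fun n => by fun_prop) (fun t _ => hanti t)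
    continuousOn_const
    fun t ht => tendsto_geometric_of_functional_equation hg0 hg (zero_lt_one.trans_le ht.1)
  rw [Metric.tendsto_nhds]
  intro δ hδ
  obtain ⟨N, hN⟩ := eventually_atTop.1 (Metric.tendstoUniformlyOn_iff.1 hunif δ hδ)
  rw [Metric.cobounded_eq_cocompact.symm]
  filter_upwards [tendsto_norm_cobounded_atTop.eventually_ge_atTop ((5 / 2 : ℝ) ^ N)] with t ht
  rw [Real.norm_eq_abs] at ht
  have hgt : g t = g |t| := by
    rcases abs_choice t with h | h <;> rw [h]
    exact (heven t).symm
  obtain ⟨n, hn1, hn2⟩ := exists_nat_pow_near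
    ((one_le_pow₀ (by norm_num : (1 : ℝ) ≤ 5 / 2)).trans ht) (by norm_num : (1 : ℝ) < 5 / 2)
  have hp : (0 : ℝ) < (5 / 2) ^ n := by positivity
  have hNn : N ≤ n := by
    by_contra! hlt
    exact absurd (hn2.trans_le ((pow_le_pow_right₀ (by norm_num) hlt).trans ht)) (lt_irrefl _)
  have h := hN n hNn (|t| / (5 / 2) ^ n)
    ⟨(one_le_div hp).2 hn1, (div_le_iff₀ hp).2 (by rw [← pow_succ']; exact hn2.le)⟩
  rw [div_mul_cancel₀ _ hp.ne', ← hgt, dist_comm] at h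
  exact h

theorem continuous_charFun_real (μ : Measure ℝ) [IsFiniteMeasure μ] : Continuous (charFun μ) := by
  fun_prop

theorem isMenshovMeasure_bernoulliConvolution : IsMenshovMeasure (bernoulliConvolution (2 / 5)) := by
  have h0 : (0 : ℝ) ≤ 2 / 5 := by norm_num
  have h1 : (2 / 5 : ℝ) < 1 := by norm_num
  have : Fact ((0 : ℝ) ≤ 2 / 5 ∧ (2 / 5 : ℝ) < 1) := ⟨h0, h1⟩
  have hK := isCompact_range_digitSeries h0 h1
  have hvol := volume_range_digitSeries h0 (by norm_num : (2 / 5 : ℝ) < 1 / 2)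
  have hnull := bernoulliConvolution_compl_range h0 h1
  have hsub : (bernoulliConvolution (2 / 5)).support ⊆ Set.range (digitSeries (2 / 5)) :=
    Measure.support_subset_of_isClosed hK.isClosed hnull
  refine ⟨inferInstance, ?_, hK.of_isClosed_subset Measure.isClosed_support hsub,
    measure_mono_null hsub hvol, ?_⟩
  · exact ⟨_, hK.measurableSet.compl, hnull, by rwa [compl_compl]⟩
  · rw [tendsto_zero_iff_norm_tendsto_zero]
    refine tendsto_cocompact_of_functional_equation (fun _ => norm_nonneg _)
      (continuous_charFun_real _).norm (fun t => ?_)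
      (norm_charFun_bernoulliConvolution h0 h1)
    rw [charFun_neg, RCLike.norm_conj]

/-! ### Membership in the Bernstein space and dilation -/

/-- The Fourier transform of a probability measure, as a bounded continuous function. -/
noncomputable def charFunBCF (μ : Measure ℝ) [IsProbabilityMeasure μ] : ℝ →ᵇ ℂ :=
  BoundedContinuousFunction.ofNormedAddCommGroup (charFun μ) (continuous_charFun_real μ) 1
    norm_charFun_le_one

@[simp]
theorem charFunBCF_apply (μ : Measure ℝ) [IsProbabilityMeasure μ] (t : ℝ) :
    charFunBCF μ t = charFun μ t := rfl

theorem norm_charFunBCF (μ : Measure ℝ) [IsProbabilityMeasure μ] : ‖charFunBCF μ‖ = 1 := by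
  refine le_antisymm (BoundedContinuousFunction.norm_ofNormedAddCommGroup_le _ zero_le_one _) ?_
  simpa using (charFunBCF μ).norm_coe_le_norm 0

/-- The required distribution is `μ` itself; the duality formula is Fubini's theorem. -/
theorem charFunBCF_mem_bernsteinSpace (μ : Measure ℝ) [IsProbabilityMeasure μ] {S : Set ℝ}
    (hS : μ Sᶜ = 0) : charFunBCF μ ∈ BernsteinSpace S := by
  refine ⟨μ.toTemperedDistribution, fun φ hφ => ?_, fun φ => ?_⟩
  · rw [Measure.toTemperedDistribution_apply μ]
    refine integral_eq_zero_of_ae ?_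
    filter_upwards [compl_mem_ae_iff.2 hS] with x hx
    exact image_eq_zero_of_notMem_tsupport fun h => hx (hφ h)
  · rw [Measure.toTemperedDistribution_apply μ]
    simp_rw [expFourier_apply, charFunBCF_apply, charFun_apply_real, ← integral_mul_const]
    rw [integral_integral_swap]
    · refine integral_congr_ae (.of_forall fun x => integral_congr_ae (.of_forall fun y => ?_))
      simp only
      congr 2
      ring
    · refine (φ.integrable.comp_snd μ).bdd_mul (c := 1)
        (Continuous.aestronglyMeasurable (by fun_prop)) (.of_forall fun p => ?_)
      rw [show Complex.I * p.1 * p.2 = ((p.1 * p.2 : ℝ) : ℂ) * Complex.I by push_cast; ring,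
        Complex.norm_exp_ofReal_mul_I]

theorem corollary1 (ε : ℝ) (hε : 0 < ε) :
    ∃ S : Set ℝ, IsCompact S ∧ volume S = 0 ∧
      ∃ f ∈ BernsteinSpace S,
        f 0 = 1 ∧ ‖f‖ = 1 ∧ (∀ t : ℝ, ε < |t| → ‖f t‖ < ε) ∧
        ∃ ν : Measure ℝ, IsMenshovMeasure ν ∧
          ∃ c : ℝ, 0 < c ∧ ∀ x : ℝ, f x = charFun ν (c * x) := by
  have hν := isMenshovMeasure_bernoulliConvolution
  set ν := bernoulliConvolution (2 / 5)
  have := hν.isProbabilityMeasure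
  have hsmall : ∀ᶠ t in cocompact ℝ, ‖charFun ν t‖ < ε := by
    simpa using hν.tendsto_zero.norm.eventually_lt_const (by simpa using hε)
  rw [← Metric.cobounded_eq_cocompact, ← comap_norm_atTop, eventually_comap] at hsmall
  obtain ⟨R, hR⟩ := eventually_atTop.1 hsmall
  -- This gives `R ≤ c * |t|` once `|t| > ε`; the maximum with `1` keeps `c` positive.
  set c := max R 1 / ε with hc
  have hc0 : 0 < c := by positivity
  have hm : Measurable (c * · : ℝ → ℝ) := by fun_prop
  have : IsProbabilityMeasure (ν.map (c * ·)) := Measure.isProbabilityMeasure_map hm.aemeasurable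
  have hcomp : IsCompact ((c * ·) '' ν.support) := hν.isCompact_support.image (by fun_prop)
  refine ⟨(c * ·) '' ν.support, hcomp, ?_, charFunBCF (ν.map (c * ·)),
    charFunBCF_mem_bernsteinSpace _ ?_, by simp, norm_charFunBCF _, fun t ht => ?_, ν, hν, c, hc0,
    fun x => by simp [charFun_map_mul]⟩
  · change volume ((fun x => c • x) '' ν.support) = 0
    rw [Set.image_smul, Measure.addHaar_smul, hν.volume_support, mul_zero]
  · rw [Measure.map_apply hm hcomp.measurableSet.compl]
    refine measure_mono_null ?_ Measure.measure_compl_support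
    exact fun x hx hxs => hx ⟨x, hxs, rfl⟩
  · rw [charFunBCF_apply, charFun_map_mul]
    refine hR _ ?_ _ rfl
    rw [Real.norm_eq_abs, abs_mul, abs_of_pos hc0]
    calc R ≤ c * ε := by rw [hc, div_mul_cancel₀ _ hε.ne']; exact le_max_left _ _
      _ ≤ c * |t| := by gcongr
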